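/- For a prime power $q$, let $\mathbb{F}_q$ be the field with $q$ elements and, for $k\ge 1$, let $\Gamma(k,q)$ be the generalized Paley graph: the Cayley graph $X(\mathbb{F}_q,R_k)$ with $R_k=\{x^k : x\in\mathbb{F}_q^*\}$, so that its vertex set is $\mathbb{F}_q$ and there is an edge from $v$ to $w$ if and only if $w-v\in R_k$. The energy of a finite graph with $n$ vertices is $E(\Gamma)=\sum_{i=1}^n|\lambda_i|$, where $\lambda_1,\dots,\lambda_n$ are the eigenvalues of its adjacency matrix counted with multiplicity, and two graphs with the same number of vertices are called equienergetic if their energies are equal. Write $\overline{\Gamma}$ for the complement of $\Gamma$. **Theorem 5.3.** Let $p$ be a prime with $p\equiv 1\pmod 4$. Then there are infinitely many $\ell\in\mathbb{N}$, $\ell\ge 1$, such that $\Gamma(4,p^{4\ell})$ and its complement $\overline{\Gamma}(4,p^{4\ell})$ are equienergetic. (These graphs are undirected, since $-1$ is a fourth power in $\mathbb{F}_{p^{4\ell}}$.) -/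

import Mathlib

open Classical in
/-- The energy `∑ |λᵢ|` of a finite simple graph, where `λ₁, …, λₙ` are the eigenvalues, listed with
multiplicity, of its (real symmetric) adjacency matrix. -/
noncomputable def graphEnergy {V : Type*} [Finite V] (G : SimpleGraph V) : ℝ :=
  letI : Fintype V := Fintype.ofFinite V
  ∑ i : V, |(G.isHermitian_adjMatrix (R := ℝ)).eigenvalues i|

/-- Two finite graphs are equienergetic if they have the same number of vertices and the same
energy. -/
def Equienergetic {V W : Type*} [Finite V] [Finite W]
    (G : SimpleGraph V) (H : SimpleGraph W) : Prop :=
  Nat.card V = Nat.card W ∧ graphEnergy G = graphEnergy H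

/-- The set `R_k = {x ^ k : x ∈ F, x ≠ 0}` of `k`-th powers of nonzero elements of a field `F`. -/
def nonzeroPowers (k : ℕ) (F : Type*) [Field F] : Set F := {y | ∃ x : F, x ≠ 0 ∧ x ^ k = y}

/-- The generalized Paley graph `X(F, R_k)`: the Cayley graph of the additive group of the field `F`
with connection set `R_k`, that is, `v` and `w` are adjacent if `w - v ∈ R_k` or `v - w ∈ R_k`.
These two conditions are equivalent when `-1` is a `k`-th power, see `generalizedPaley_adj`; for
`k = 4` this holds if `8` divides `|F| - 1`, see `gpGraph_four_adj`. -/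
def generalizedPaley (k : ℕ) (F : Type*) [Field F] : SimpleGraph F :=
  SimpleGraph.addCayley (nonzeroPowers k F)

/-- The graph `Γ(k, q)` over the finite field with `q = p ^ m` elements (`m ≠ 0`). -/
noncomputable def gpGraph (k p m : ℕ) [Fact p.Prime] : SimpleGraph (GaloisField p m) :=
  generalizedPaley k (GaloisField p m)

theorem generalizedPaley_adj {k : ℕ} {F : Type*} [Field F] (h : -1 ∈ nonzeroPowers k F) (v w : F) :
    (generalizedPaley k F).Adj v w ↔ w - v ∈ nonzeroPowers k F := by
  obtain ⟨e, he0, he⟩ := h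
  rw [generalizedPaley, SimpleGraph.addCayley_adj']
  constructor
  · rintro ⟨-, g, ⟨x, hx, rfl⟩, h | h⟩
    · exact ⟨x, hx, by rw [← h]; ring⟩
    · exact ⟨e * x, mul_ne_zero he0 hx, by rw [mul_pow, he, h]; ring⟩
  · rintro ⟨x, hx, h⟩
    refine ⟨?_, w - v, ⟨x, hx, h⟩, Or.inl (by ring)⟩
    rintro rfl
    exact pow_ne_zero k hx (by rw [h, sub_self])

theorem neg_one_mem_nonzeroPowers_four {F : Type*} [Field F] [Finite F]
    (h : 8 ∣ Nat.card F - 1) : (-1 : F) ∈ nonzeroPowers 4 F := by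
  obtain ⟨g, hg⟩ := IsCyclic.exists_ofOrder_eq_natCard (α := Fˣ)
  obtain ⟨c, hc⟩ := h
  have hcard : Nat.card Fˣ = Nat.card F - 1 := Nat.card_units F
  have hpos : 0 < Nat.card Fˣ := Nat.card_pos
  rw [hcard, hc] at hg hpos
  refine ⟨((g ^ c : Fˣ) : F), Units.ne_zero _, ?_⟩
  have h1 : (((g ^ c : Fˣ) : F) ^ 4) ^ 2 = 1 := by
    rw [← pow_mul, ← Units.val_pow_eq_pow_val, ← pow_mul,
      show c * (4 * 2) = orderOf g by rw [hg]; ring, pow_orderOf_eq_one, Units.val_one]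
  rcases eq_or_eq_neg_of_sq_eq_sq _ 1 (h1.trans (one_pow 2).symm) with h2 | h2
  · exfalso
    rw [← Units.val_pow_eq_pow_val, ← pow_mul, Units.val_eq_one] at h2
    have := Nat.le_of_dvd (by omega) (orderOf_dvd_of_pow_eq_one h2)
    omega
  · exact h2

theorem gpGraph_four_adj {p : ℕ} [Fact p.Prime] (hp : p % 4 = 1) {ℓ : ℕ} (hl : 0 < ℓ)
    (v w : GaloisField p (4 * ℓ)) :
    (gpGraph 4 p (4 * ℓ)).Adj v w ↔ w - v ∈ nonzeroPowers 4 (GaloisField p (4 * ℓ)) := by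
  refine generalizedPaley_adj (neg_one_mem_nonzeroPowers_four ?_) v w
  rw [GaloisField.card p _ (by omega)]
  have h : p ^ (4 * ℓ) ≡ 1 [MOD 8] := by
    rw [pow_mul]
    have h4 : p ^ 4 ≡ 1 [MOD 8] := by
      have h8 : p % 8 = 1 ∨ p % 8 = 5 := by omega
      rcases h8 with h8 | h8 <;> simp [Nat.ModEq, Nat.pow_mod, h8]
    simpa using h4.pow ℓ
  exact (Nat.modEq_iff_dvd' (Nat.one_le_pow _ _ (by omega))).mp h.symm

/-! Over the field with q elements, the eigenvalues of the graph are its degree (q-1)/4 and four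
quartic Gaussian periods η, each taken (q-1)/4 times; the complement has 3(q-1)/4 and the numbers
-1-η. So the energies agree exactly when the four values |1+η|-|η| sum to -2, in particular when
three periods are ≤ -1 and the fourth is ≥ 0 (`graphEnergy_eq_graphEnergy_compl`).

Let π = a+bi be the Jacobi sum J(χ,χ) of a quartic character of F_p, so |π|² = p. For q = p^(4·2^k)
and Q = √q, iterating the quadratic Hasse–Davenport relation (`exists_quadratic_lift_gaussSum`)
gives a quartic Gauss sum -Q·e^(iθ) with e^(iθ) = (π²/p)^(2^k), and a quadratic one -Q. The numbers
4η are then -1-Q±2Q cos θ and -1+Q±2Q sin θ, with the required signs once |2 cos θ| < 1 by a small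
margin (`exists_quartic_period_sign`).

Raising k by one doubles θ, so x = 2 cos θ moves by x ↦ x²-2. An orbit below 2 that avoids -1 enters
(-1,1) infinitely often (`exists_abs_lt_one_of_sq_sub_two`); here x is never an integer, because its
numerator is prime to p (`not_dvd_gaussianPowTrace`). -/

/-! ### Graph energy through additive characters -/

open Classical in
-- U need not be unitary: only the multisets of roots of the characteristic polynomial are compared.
theorem graphEnergy_eq_sum_norm {V : Type*} [Fintype V] (G : SimpleGraph V)
    (U : Matrix V V ℂ) (hU : IsUnit U) (d : V → ℂ)
    (h : G.adjMatrix ℂ * U = U * Matrix.diagonal d) :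
    graphEnergy G = ∑ v, ‖d v‖ := by
  have hA := G.isHermitian_adjMatrix (R := ℝ)
  have key : ∑ i : V, |hA.eigenvalues i| = ∑ v, ‖d v‖ := by
    have h1 : (G.adjMatrix ℂ).charpoly.roots =
        Finset.univ.val.map (fun i ↦ (hA.eigenvalues i : ℂ)) := by
      have hm : G.adjMatrix ℂ = (G.adjMatrix ℝ).map (algebraMap ℝ ℂ) := by
        ext i j
        simp [SimpleGraph.adjMatrix_apply, apply_ite]
      rw [hm, Matrix.charpoly_map, hA.charpoly_eq, Polynomial.map_prod]
      simp only [Polynomial.map_sub, Polynomial.map_X, Polynomial.map_C]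
      rw [Polynomial.roots_prod _ _ (Finset.prod_ne_zero_iff.mpr fun i _ ↦
        Polynomial.X_sub_C_ne_zero _)]
      simp [Multiset.bind_singleton]
    have h2 : (G.adjMatrix ℂ).charpoly.roots = Finset.univ.val.map d := by
      obtain ⟨u, rfl⟩ := hU
      have hd : G.adjMatrix ℂ = u.val * Matrix.diagonal d * (u⁻¹).val := by
        rw [← h, mul_assoc, Units.mul_inv, mul_one]
      rw [hd, mul_assoc, Matrix.charpoly_mul_comm, mul_assoc, Units.inv_mul, mul_one,
        Matrix.charpoly_diagonal,
        Polynomial.roots_prod _ _ (Finset.prod_ne_zero_iff.mpr fun i _ ↦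
        Polynomial.X_sub_C_ne_zero _)]
      simp [Multiset.bind_singleton]
    have h3 := congrArg (fun m : Multiset ℂ ↦ (m.map (fun z : ℂ ↦ ‖z‖)).sum) (h1.symm.trans h2)
    simp only [Multiset.map_map, Function.comp_def, Complex.norm_real, Real.norm_eq_abs] at h3
    exact h3
  rw [← key, graphEnergy]
  congr!

open Classical in
-- The functions x ↦ ψ(ax) are eigenvectors, and orthogonality of characters makes their matrix
-- invertible.
theorem graphEnergy_eq_sum_norm_charSum {F : Type*} [Field F] [Fintype F] {ψ : AddChar F ℂ}
    (hψ : ψ.IsPrimitive) (G : SimpleGraph F) (S : Finset F)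
    (hG : ∀ v w, G.Adj v w ↔ w - v ∈ S) :
    graphEnergy G = ∑ a, ‖∑ s ∈ S, ψ (a * s)‖ := by
  refine graphEnergy_eq_sum_norm G (Matrix.of fun x a ↦ ψ (a * x)) ?_ _ ?_
  · have hcard : (Fintype.card F : ℂ) ≠ 0 := by simp
    have hmul : (Matrix.of fun x a ↦ ψ (a * x)) * (Matrix.of fun a y ↦ ψ (-(a * y))) =
        (Fintype.card F : ℂ) • (1 : Matrix F F ℂ) := by
      ext x y
      have := AddChar.sum_mulShift (x - y) hψ
      simp only [Matrix.mul_apply, Matrix.of_apply, ← AddChar.map_add_eq_mul,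
        ← sub_eq_add_neg, ← mul_sub, Matrix.smul_apply, Matrix.one_apply, smul_eq_mul]
      rw [this]
      simp [sub_eq_zero]
    refine (Matrix.isUnit_iff_isUnit_det _).mpr (isUnit_iff_ne_zero.mpr fun h0 ↦ ?_)
    have := congrArg Matrix.det hmul
    rw [Matrix.det_mul, h0, zero_mul, Matrix.det_smul, Matrix.det_one, mul_one] at this
    exact pow_ne_zero _ hcard this.symm
  · ext v a
    rw [Matrix.mul_diagonal, Matrix.mul_apply]
    simp only [SimpleGraph.adjMatrix_apply, Matrix.of_apply, hG, ite_mul, one_mul, zero_mul]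
    rw [← Equiv.sum_comp (Equiv.addRight v), Finset.mul_sum]
    simp only [Equiv.coe_addRight, add_sub_cancel_right, Finset.sum_ite_mem, Finset.univ_inter]
    refine Finset.sum_congr rfl fun s _ ↦ ?_
    rw [← AddChar.map_add_eq_mul]
    ring_nf

open Classical in
theorem graphEnergy_compl_eq_sum_norm {F : Type*} [Field F] [Fintype F] {ψ : AddChar F ℂ}
    (hψ : ψ.IsPrimitive) (G : SimpleGraph F) (S : Finset F) (h0 : 0 ∉ S)
    (hG : ∀ v w, G.Adj v w ↔ w - v ∈ S) :
    graphEnergy Gᶜ = ∑ a, ‖(if a = 0 then (Fintype.card F : ℂ) else 0) - 1 -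
      ∑ s ∈ S, ψ (a * s)‖ := by
  rw [graphEnergy_eq_sum_norm_charSum hψ Gᶜ (insert 0 S)ᶜ]
  · refine Finset.sum_congr rfl fun a _ ↦ ?_
    have h1 := Finset.sum_compl_add_sum (insert 0 S) (fun s ↦ ψ (a * s))
    have h2 := AddChar.sum_mulShift a hψ
    simp only [mul_comm _ a] at h2
    rw [Finset.sum_insert h0, h2, mul_zero, AddChar.map_zero_eq_one] at h1
    congr 1
    push_cast at h1
    linear_combination h1
  · intro v w
    simp [hG, sub_eq_zero, eq_comm]

/-! ### Hasse–Davenport for quadratic extensions -/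

/-- With η the quadratic character, d has 1+η(d) preimages under w ↦ w² and 1-η(d) under v ↦ δv². -/
theorem sum_comp_sq_add_sum_comp_mul_sq {F : Type*} [Field F] [Fintype F] (hF : ringChar F ≠ 2)
    {δ : F} (hδ : ¬IsSquare δ) (H : F → ℂ) :
    ∑ w, H (w ^ 2) + ∑ v, H (δ * v ^ 2) = 2 * ∑ d, H d := by
  classical
  have hδ0 : δ ≠ 0 := fun h ↦ hδ (h ▸ IsSquare.zero)
  have count (c : F) : ((Finset.univ.filter fun x : F ↦ x ^ 2 = c).card : ℂ) =
      quadraticChar F c + 1 := by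
    have := quadraticChar_card_sqrts hF c
    rw [Set.toFinset_ofPred] at this
    exact_mod_cast congrArg (Int.cast : ℤ → ℂ) this
  have h1 : ∑ w, H (w ^ 2) = ∑ d, (quadraticChar F d + 1 : ℂ) * H d := by
    rw [← Finset.sum_fiberwise Finset.univ (fun w : F ↦ w ^ 2)]
    refine Finset.sum_congr rfl fun d _ ↦ ?_
    rw [← count, ← nsmul_eq_mul]
    exact Finset.sum_eq_card_nsmul fun w hw ↦ by rw [(Finset.mem_filter.mp hw).2]
  have h2 : ∑ v, H (δ * v ^ 2) = ∑ d, (-quadraticChar F d + 1 : ℂ) * H d := by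
    rw [← Finset.sum_fiberwise Finset.univ (fun v : F ↦ v ^ 2),
      ← Equiv.sum_comp (Equiv.mulLeft₀ δ hδ0) (fun d ↦ (-quadraticChar F d + 1 : ℂ) * H d)]
    refine Finset.sum_congr rfl fun d _ ↦ ?_
    have hd : (-quadraticChar F (δ * d) + 1 : ℂ) = quadraticChar F d + 1 := by
      rw [map_mul, quadraticChar_neg_one_iff_not_isSquare.mpr hδ]
      push_cast
      ring
    change _ = (-quadraticChar F (δ * d) + 1 : ℂ) * H (δ * d)
    rw [hd, ← count, ← nsmul_eq_mul]
    exact Finset.sum_eq_card_nsmul fun w hw ↦ by rw [(Finset.mem_filter.mp hw).2]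
  rw [h1, h2, ← Finset.sum_add_distrib, Finset.mul_sum]
  exact Finset.sum_congr rfl fun d _ ↦ by ring

/-- Both Gauss sums are sorted by trace t: the norm t²/4-δv² on K faces the split form t²/4-w² on
F×F. For fixed t the two inner sums add up to a multiple of ψ(t) independent of t otherwise, and ψ
sums to zero. -/
theorem gaussSum_quadratic_lift {F K : Type*} [Field F] [Fintype F] [Field K] [Fintype K]
    [Algebra F K] (hF : ringChar F ≠ 2) {δ : F} (hδ : ¬IsSquare δ) {s : K}
    (hcoord : Function.Bijective fun x : F × F ↦ algebraMap F K x.1 + algebraMap F K x.2 * s)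
    {χ : MulChar F ℂ} {ψ : AddChar F ℂ} (hψ : ψ ≠ 1) {χ' : MulChar K ℂ} {ψ' : AddChar K ℂ}
    (hχ' : ∀ u v, χ' (algebraMap F K u + algebraMap F K v * s) = χ (u ^ 2 - δ * v ^ 2))
    (hψ' : ∀ u v, ψ' (algebraMap F K u + algebraMap F K v * s) = ψ (2 * u)) :
    gaussSum χ' ψ' = -gaussSum χ ψ ^ 2 := by
  have h2 : (2 : F) ≠ 0 := Ring.two_ne_zero hF
  have hK : gaussSum χ' ψ' = ∑ t, ∑ v, χ ((t / 2) ^ 2 - δ * v ^ 2) * ψ t := by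
    rw [gaussSum, ← (Equiv.ofBijective _ hcoord).sum_comp, Fintype.sum_prod_type,
      ← Equiv.sum_comp (Equiv.divRight₀ (2 : F) h2)]
    refine Finset.sum_congr rfl fun t _ ↦ Finset.sum_congr rfl fun v _ ↦ ?_
    simp only [Equiv.ofBijective_apply, hχ', hψ', Equiv.divRight₀_apply, mul_div_cancel₀ _ h2]
  have hFF : gaussSum χ ψ ^ 2 = ∑ t, ∑ w, χ ((t / 2) ^ 2 - w ^ 2) * ψ t := by
    -- The change x = t/2+w, y = t/2-w, with x+y = t and xy = t²/4-w².
    let e : F × F ≃ F × F :=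
      { toFun := fun x ↦ (x.1 / 2 + x.2, x.1 / 2 - x.2)
        invFun := fun y ↦ (y.1 + y.2, (y.1 - y.2) / 2)
        left_inv := fun x ↦ by ext <;> simp <;> field_simp <;> ring
        right_inv := fun y ↦ by ext <;> simp <;> field_simp <;> ring }
    rw [sq, gaussSum, Finset.sum_mul_sum, ← Fintype.sum_prod_type', ← Fintype.sum_prod_type',
      ← e.sum_comp]
    refine Finset.sum_congr rfl fun x _ ↦ ?_
    rw [mul_mul_mul_comm, ← map_mul, ← AddChar.map_add_eq_mul]
    congr 2 <;> simp only [e, Equiv.coe_fn_mk] <;> field_simp <;> ring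
  rw [eq_neg_iff_add_eq_zero, add_comm, hK, hFF, ← Finset.sum_add_distrib]
  have key (t : F) : ∑ w, χ ((t / 2) ^ 2 - w ^ 2) * ψ t +
      ∑ v, χ ((t / 2) ^ 2 - δ * v ^ 2) * ψ t = 2 * (∑ d, χ d) * ψ t := by
    rw [sum_comp_sq_add_sum_comp_mul_sq hF hδ (fun d ↦ χ ((t / 2) ^ 2 - d) * ψ t),
      ← Finset.sum_mul, ← Equiv.sum_comp (Equiv.subLeft ((t / 2) ^ 2)) (fun d ↦ χ d), mul_assoc]
    rfl
  simp_rw [key]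
  rw [← Finset.mul_sum, AddChar.sum_eq_zero_of_ne_one hψ, mul_zero]

theorem FiniteField.exists_quadratic_coordinates {F K : Type*} [Field F] [Fintype F] [Field K]
    [Fintype K] [Algebra F K] (hF : ringChar F ≠ 2) (hcard : Fintype.card K = Fintype.card F ^ 2) :
    ∃ (δ : F) (s : K), ¬IsSquare δ ∧
      (Function.Bijective fun x : F × F ↦ algebraMap F K x.1 + algebraMap F K x.2 * s) ∧
      (∀ u v, Algebra.norm F (algebraMap F K u + algebraMap F K v * s) = u ^ 2 - δ * v ^ 2) ∧
      ∀ u v, Algebra.trace F K (algebraMap F K u + algebraMap F K v * s) = 2 * u := by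
  obtain ⟨δ, hδ⟩ := FiniteField.exists_nonsquare hF
  have hδ0 : δ ≠ 0 := fun h ↦ hδ (h ▸ IsSquare.zero)
  have hodd := FiniteField.odd_card_of_char_ne_two hF
  have hq1 := Fintype.one_lt_card (α := F)
  set q := Fintype.card F with hq
  obtain ⟨m, hm⟩ : ∃ m, q = 2 * m + 1 := ⟨q / 2, by omega⟩
  have hK : ringChar K ≠ 2 := by
    rwa [← Algebra.ringChar_eq F K]
  have hδm : δ ^ m = -1 := by
    have h1 := FiniteField.pow_dichotomy hF hδ0
    have h2 := FiniteField.isSquare_iff hF hδ0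
    rw [← hq, show q / 2 = m by omega] at h1 h2
    exact h1.resolve_left fun h ↦ hδ (h2.mpr h)
  -- (q²-1)/2 is an even multiple of m = (q-1)/2, so Euler's criterion makes δ a square in K.
  obtain ⟨s, hs⟩ : IsSquare (algebraMap F K δ) := by
    rw [FiniteField.isSquare_iff hK (by simpa using hδ0), hcard, ← map_pow,
      show q ^ 2 / 2 = m * (2 * (m + 1)) by
        rw [hm, show (2 * m + 1) ^ 2 = 2 * (m * (2 * (m + 1))) + 1 by ring]; omega,
      pow_mul, hδm, pow_mul]
    simp
  have hsF (c : F) : algebraMap F K c ≠ s := by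
    rintro rfl
    exact hδ ⟨c, (algebraMap F K).injective (by simpa using hs)⟩
  have hinj : Function.Injective
      fun x : F × F ↦ algebraMap F K x.1 + algebraMap F K x.2 * s := by
    rintro ⟨a, b⟩ ⟨c, d⟩ h
    simp only at h
    by_cases hbd : b = d
    · subst hbd
      simpa using h
    · exfalso
      have hbd' : algebraMap F K (b - d) ≠ 0 := by simpa [sub_eq_zero] using hbd
      apply hsF ((c - a) / (b - d))
      rw [map_div₀, div_eq_iff hbd', map_sub, map_sub]
      linear_combination -h
  -- Since δ^m = -1, Frobenius sends s to -s; norm and trace are then the product and sum of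
  -- conjugates.
  have hfrob (u v : F) : (algebraMap F K u + algebraMap F K v * s) ^ q =
      algebraMap F K u - algebraMap F K v * s := by
    have hsq : s ^ q = -s := by
      rw [hm, pow_succ, pow_mul, sq, ← hs, ← map_pow, hδm]
      simp
    have h3 := map_add (FiniteField.frobeniusAlgHom F K) (algebraMap F K u) (algebraMap F K v * s)
    rw [map_mul] at h3
    simp only [AlgHom.commutes] at h3
    simp only [FiniteField.frobeniusAlgHom_apply, ← hq, hsq] at h3
    rw [h3]
    ring
  have hfin : Module.finrank F K = 2 := by
    have := Module.card_eq_pow_finrank (K := F) (V := K)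
    rw [hcard] at this
    exact (Nat.pow_right_injective hq1 this).symm
  refine ⟨δ, s, hδ, ?_, fun u v ↦ ?_, fun u v ↦ ?_⟩
  · rw [Fintype.bijective_iff_injective_and_card]
    exact ⟨hinj, by rw [Fintype.card_prod, hcard, sq]⟩
  · apply (algebraMap F K).injective
    rw [FiniteField.algebraMap_norm_eq_pow, Nat.card_eq_fintype_card, Nat.card_eq_fintype_card,
      hcard, ← hq, show (q ^ 2 - 1) / (q - 1) = q + 1 by
        rw [show q ^ 2 - 1 = (q + 1) * (q - 1) by simpa using Nat.sq_sub_sq q 1]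
        exact Nat.mul_div_cancel _ (by omega), pow_succ, hfrob]
    simp only [map_sub, map_pow, map_mul, hs]
    ring
  · apply (algebraMap F K).injective
    rw [FiniteField.algebraMap_trace_eq_sum_pow, hfin]
    simp only [Finset.sum_range_succ, Finset.sum_range_zero, Nat.card_eq_fintype_card, ← hq,
      pow_zero, pow_one, hfrob, map_mul, map_ofNat]
    ring

/-- The Hasse–Davenport relation for a quadratic extension of finite fields. -/
theorem exists_quadratic_lift_gaussSum {F K : Type*} [Field F] [Fintype F] [Field K] [Fintype K]
    [Algebra F K] (hF : ringChar F ≠ 2) (hcard : Fintype.card K = Fintype.card F ^ 2)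
    {ψ : AddChar F ℂ} (hψ : ψ.IsPrimitive) :
    ∃ ψ' : AddChar K ℂ, ψ'.IsPrimitive ∧ ∃ Φ : MulChar F ℂ →* MulChar K ℂ,
      Function.Injective Φ ∧ ∀ χ, gaussSum (Φ χ) ψ' = -gaussSum χ ψ ^ 2 := by
  obtain ⟨δ, s, hδ, hbij, hnorm, htrace⟩ :=
    FiniteField.exists_quadratic_coordinates (K := K) hF hcard
  have hψ1 : ψ ≠ 1 := by simpa [AddChar.mulShift_one] using hψ one_ne_zero
  let Φ : MulChar F ℂ →* MulChar K ℂ :=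
    { toFun := fun χ ↦ MulChar.ofUnitHom (χ.toUnitHom.comp (Units.map (Algebra.norm F)))
      map_one' := by ext a; simpa using MulChar.one_apply (a.isUnit.map (Algebra.norm F))
      map_mul' := fun χ χ' ↦ by ext a; simp }
  have hΦu (χ : MulChar F ℂ) (a : Kˣ) : Φ χ a = χ (Algebra.norm F (a : K)) := by
    simp [Φ]
  have hΦ (χ : MulChar F ℂ) (a : K) : Φ χ a = χ (Algebra.norm F a) := by
    rcases eq_or_ne a 0 with rfl | ha
    · rw [MulChar.map_zero, Algebra.norm_zero, MulChar.map_zero]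
    · exact hΦu χ (Units.mk0 a ha)
  refine ⟨ψ.compAddMonoidHom (Algebra.trace F K).toAddMonoidHom, ?_, Φ, ?_, fun χ ↦ ?_⟩
  · refine AddChar.IsPrimitive.of_ne_one ?_
    obtain ⟨a, ha⟩ := AddChar.ne_one_iff.mp hψ1
    refine AddChar.ne_one_iff.mpr ⟨algebraMap F K (a / 2), ?_⟩
    have := htrace (a / 2) 0
    rw [map_zero, zero_mul, add_zero, mul_div_cancel₀ _ (Ring.two_ne_zero hF)] at this
    rw [AddChar.compAddMonoidHom_apply]
    exact fun h ↦ ha (by rw [← this]; exact h)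
  · intro χ χ' h
    ext a
    obtain ⟨b, rfl⟩ := FiniteField.unitsMap_norm_surjective F K a
    simpa [hΦu] using congrArg (fun f : MulChar K ℂ ↦ f b) h
  · refine gaussSum_quadratic_lift hF hδ hbij hψ1 (fun u v ↦ ?_) fun u v ↦ ?_
    · rw [hΦ, hnorm]
    · simp [AddChar.compAddMonoidHom_apply, htrace]

/-- Each quadratic step squares the negated Gauss sum. Injectivity of Φ preserves the order of the
character. -/
theorem GaloisField.exists_gaussSum_two_pow (p : ℕ) [Fact p.Prime] (hp : p ≠ 2)
    [∀ n, Fintype (GaloisField p n)] {ψ : AddChar (GaloisField p 1) ℂ} (hψ : ψ.IsPrimitive)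
    (k : ℕ) :
    ∃ ψ' : AddChar (GaloisField p (2 ^ k)) ℂ, ψ'.IsPrimitive ∧
      ∃ Φ : MulChar (GaloisField p 1) ℂ →* MulChar (GaloisField p (2 ^ k)) ℂ,
        Function.Injective Φ ∧ ∀ χ, gaussSum (Φ χ) ψ' = -(-gaussSum χ ψ) ^ 2 ^ k := by
  induction k with
  | zero => exact ⟨ψ, hψ, MonoidHom.id _, fun _ _ h ↦ h, fun χ ↦ by simp⟩
  | succ k ih =>
    obtain ⟨ψ₁, hψ₁, Φ₁, hΦ₁, h₁⟩ := ih
    have hfr (j : ℕ) : Module.finrank (ZMod p) (GaloisField p (2 ^ j)) = 2 ^ j :=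
      GaloisField.finrank p (by positivity)
    obtain ⟨f⟩ := FiniteField.nonempty_algHom_of_finrank_dvd (F := ZMod p)
      (K := GaloisField p (2 ^ k)) (L := GaloisField p (2 ^ (k + 1)))
      (by rw [hfr, hfr]; exact pow_dvd_pow 2 k.le_succ)
    let _ := f.toRingHom.toAlgebra
    have hchar : ringChar (GaloisField p (2 ^ k)) ≠ 2 := by
      rwa [ringChar.eq (GaloisField p (2 ^ k)) p]
    obtain ⟨ψ₂, hψ₂, Φ₂, hΦ₂, h₂⟩ := exists_quadratic_lift_gaussSum
      (K := GaloisField p (2 ^ (k + 1))) hchar (by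
        rw [← Nat.card_eq_fintype_card, ← Nat.card_eq_fintype_card,
          GaloisField.card p _ (by positivity), GaloisField.card p _ (by positivity), ← pow_mul,
          pow_succ]) hψ₁
    refine ⟨ψ₂, hψ₂, Φ₂.comp Φ₁, hΦ₂.comp hΦ₁, fun χ ↦ ?_⟩
    rw [MonoidHom.comp_apply, h₂, h₁, neg_sq, ← pow_mul, pow_succ]

/-! ### Quartic Gauss and Jacobi sums -/

theorem mem_adjoin_I_iff {z : ℂ} :
    z ∈ Algebra.adjoin ℤ {Complex.I} ↔ ∃ a b : ℤ, z = a + b * Complex.I := by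
  constructor
  · intro h
    induction h using Algebra.adjoin_induction with
    | mem x hx => exact ⟨0, 1, by simpa using hx⟩
    | algebraMap r => exact ⟨r, 0, by simp⟩
    | add x y _ _ hx hy =>
      obtain ⟨a, b, rfl⟩ := hx
      obtain ⟨c, d, rfl⟩ := hy
      exact ⟨a + c, b + d, by push_cast; ring⟩
    | mul x y _ _ hx hy =>
      obtain ⟨a, b, rfl⟩ := hx
      obtain ⟨c, d, rfl⟩ := hy
      exact ⟨a * c - b * d, a * d + b * c, by
        push_cast; linear_combination (b * d : ℂ) * Complex.I_sq⟩
  · rintro ⟨a, b, rfl⟩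
    exact add_mem (algebraMap_mem _ a)
      (mul_mem (algebraMap_mem _ b) (Algebra.subset_adjoin rfl))

/-- Here a+bi = J(χ,χ), and g(χ)² = J(χ,χ)·g(χ²), while g(χ²)² = χ²(-1)·|F| = |F|. -/
theorem exists_gaussSum_pow_four {F : Type*} [Field F] [Fintype F] {χ : MulChar F ℂ}
    (hχ : orderOf χ = 4) {ψ : AddChar F ℂ} (hψ : ψ.IsPrimitive) :
    ∃ a b : ℤ, a ^ 2 + b ^ 2 = Fintype.card F ∧
      gaussSum χ ψ ^ 4 = Fintype.card F * (a + b * Complex.I) ^ 2 ∧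
      gaussSum (χ ^ 2) ψ ^ 2 = Fintype.card F := by
  have hne {n : ℕ} (h0 : n ≠ 0) (h4 : n < 4) : χ ^ n ≠ 1 :=
    pow_ne_one_of_lt_orderOf h0 (hχ ▸ h4)
  have hχ1 : χ ≠ 1 := by simpa using hne (n := 1) (by norm_num) (by norm_num)
  have hχ2 : χ * χ ≠ 1 := by simpa [sq] using hne (n := 2) (by norm_num) (by norm_num)
  have hχ4 : χ ^ 4 = 1 := hχ ▸ pow_orderOf_eq_one χ
  have hI : IsPrimitiveRoot Complex.I 4 := Complex.isPrimitiveRoot_I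
  obtain ⟨a, b, hJ⟩ := mem_adjoin_I_iff.mp (jacobiSum_mem_algebraAdjoin_of_pow_eq_one hχ4 hχ4 hI)
  have hsq : gaussSum (χ ^ 2) ψ ^ 2 = Fintype.card F := by
    rw [gaussSum_sq (by rwa [sq]) (MulChar.isQuadratic_iff_sq_eq_one.mpr (by
      rw [← pow_mul, hχ4])) hψ, MulChar.pow_apply' _ two_ne_zero, ← map_pow]
    simp
  refine ⟨a, b, ?_, ?_, hsq⟩
  · have hchar : ringChar ℂ ≠ ringChar F := by
      rw [ringChar.eq_zero]
      exact (CharP.ringChar_ne_zero_of_finite F).symm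
    have h1 := jacobiSum_mul_jacobiSum_inv hchar hχ1 hχ1 hχ2
    have h2 : jacobiSum χ⁻¹ χ⁻¹ = star (jacobiSum χ χ) := by
      simp [jacobiSum, MulChar.star_apply', star_sum, star_mul, mul_comm]
    rw [h2, hJ] at h1
    have h3 : ((a ^ 2 + b ^ 2 : ℤ) : ℂ) = (Fintype.card F : ℤ) := by
      push_cast
      rw [← h1]
      simp
      linear_combination (b ^ 2 : ℂ) * Complex.I_sq
    exact_mod_cast h3
  · have h1 := jacobiSum_mul_nontrivial hχ2 ψ
    rw [hJ, ← sq, ← sq] at h1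
    rw [← hsq, ← mul_pow, h1]
    ring

theorem GaloisField.exists_quartic_gaussSum (p : ℕ) [Fact p.Prime] (hp : p % 4 = 1)
    [∀ n, Fintype (GaloisField p n)] :
    ∃ a b : ℤ, a ^ 2 + b ^ 2 = p ∧ ∀ k : ℕ,
      ∃ (ψ : AddChar (GaloisField p (4 * 2 ^ k)) ℂ) (χ : MulChar (GaloisField p (4 * 2 ^ k)) ℂ),
        ψ.IsPrimitive ∧ orderOf χ = 4 ∧
        gaussSum χ ψ = -((p : ℂ) * (a + b * Complex.I) ^ 2) ^ 2 ^ k ∧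
        gaussSum (χ ^ 2) ψ = -((p : ℂ) ^ 2) ^ 2 ^ k := by
  have hcard : Fintype.card (GaloisField p 1) = p := by
    rw [← Nat.card_eq_fintype_card, GaloisField.card p 1 one_ne_zero, pow_one]
  obtain ⟨χ, hχ⟩ := MulChar.exists_mulChar_orderOf (GaloisField p 1) (n := 4)
    (by rw [hcard]; omega) Complex.isPrimitiveRoot_I
  obtain ⟨ψ, hψ⟩ : ∃ ψ : AddChar (GaloisField p 1) ℂ, ψ.IsPrimitive := by
    obtain ⟨ψ, hψ⟩ := AddChar.exists_apply_ne_zero.mpr (one_ne_zero : (1 : GaloisField p 1) ≠ 0)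
    exact ⟨ψ, AddChar.IsPrimitive.of_ne_one (AddChar.ne_one_iff.mpr ⟨1, hψ⟩)⟩
  obtain ⟨a, b, hab, h4, h2⟩ := exists_gaussSum_pow_four hχ hψ
  rw [hcard] at hab h4 h2
  refine ⟨a, b, hab, fun k ↦ ?_⟩
  -- Two of the k+2 doublings produce the fourth power of the Gauss sum, which is known explicitly.
  rw [show 4 * 2 ^ k = 2 ^ (k + 2) by ring]
  obtain ⟨ψ', hψ', Φ, hΦ, h⟩ := GaloisField.exists_gaussSum_two_pow p (by omega) hψ (k + 2)
  refine ⟨ψ', Φ χ, hψ', by rw [orderOf_injective Φ hΦ, hχ], ?_, ?_⟩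
  · rw [h, ← h4, ← pow_mul, show 2 ^ (k + 2) = 4 * 2 ^ k by ring, pow_mul, pow_mul]
    congr 2
    ring
  · rw [← map_pow, h, ← h2, show 2 ^ (k + 2) = 4 * 2 ^ k by ring, pow_mul]
    congr 2
    ring

/-! ### Quartic periods and the energy criterion -/

theorem MulChar.apply_eq_one_iff_mem_nonzeroPowers {F : Type*} [Field F] [Finite F]
    (χ : MulChar F ℂ) {s : F} (hs : s ≠ 0) :
    χ s = 1 ↔ s ∈ nonzeroPowers (orderOf χ) F := by
  constructor
  · intro h
    obtain ⟨g, hg⟩ := IsCyclic.exists_monoid_generator (α := Fˣ)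
    obtain ⟨k, hk⟩ := hg (Units.mk0 s hs)
    have hsk : s = (g : F) ^ k := by
      simpa using (congrArg Units.val hk).symm
    have hdvd : orderOf χ ∣ k := by
      refine orderOf_dvd_of_pow_eq_one ?_
      rw [MulChar.eq_iff fun x ↦ ?_, MulChar.pow_apply_coe, ← map_pow, ← hsk, h,
        MulChar.one_apply_coe]
      obtain ⟨j, hj⟩ := hg x
      exact ⟨j, by simpa using hj⟩
    obtain ⟨j, rfl⟩ := hdvd
    exact ⟨(g : F) ^ j, pow_ne_zero _ g.ne_zero, by rw [hsk, ← pow_mul, mul_comm]⟩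
  · rintro ⟨x, hx, rfl⟩
    have h1 := MulChar.pow_apply_coe χ (orderOf χ) (Units.mk0 x hx)
    rw [pow_orderOf_eq_one, MulChar.one_apply_coe] at h1
    rw [map_pow]
    exact h1.symm

theorem MulChar.four_mul_indicator {F : Type*} [Field F] [Fintype F]
    {χ : MulChar F ℂ} (hχ : orderOf χ = 4) (s : F) [Decidable (s ∈ nonzeroPowers 4 F)] :
    (4 * if s ∈ nonzeroPowers 4 F then 1 else 0 : ℂ) =
      (1 : MulChar F ℂ) s + χ s + (χ ^ 2) s + (χ ^ 3) s := by
  rcases eq_or_ne s 0 with rfl | hs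
  · rw [if_neg (by rintro ⟨x, hx, h⟩; exact pow_ne_zero _ hx h)]
    simp only [MulChar.map_zero]
    ring
  · have h4 : χ s ^ 4 = 1 := by
      have h1 := MulChar.pow_apply' χ four_ne_zero s
      rw [← h1, ← hχ, pow_orderOf_eq_one, MulChar.one_apply (isUnit_iff_ne_zero.mpr hs)]
    have hiff := χ.apply_eq_one_iff_mem_nonzeroPowers hs
    rw [hχ] at hiff
    rw [MulChar.one_apply (isUnit_iff_ne_zero.mpr hs), MulChar.pow_apply' _ two_ne_zero,
      MulChar.pow_apply' _ three_ne_zero]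
    split_ifs with h
    · rw [hiff.mpr h]
      norm_num
    -- Geometric sum: its product with χ(s)-1 is χ(s)⁴-1 = 0.
    · have h1 : χ s - 1 ≠ 0 := sub_ne_zero.mpr (mt hiff.mp h)
      refine mul_left_cancel₀ h1 ?_
      linear_combination -h4

open Classical in
theorem four_mul_sum_nonzeroPowers {F : Type*} [Field F] [Fintype F]
    {χ : MulChar F ℂ} (hχ : orderOf χ = 4) (f : F → ℂ) :
    4 * ∑ s with s ∈ nonzeroPowers 4 F, f s =
      ∑ s, (1 : MulChar F ℂ) s * f s + ∑ s, χ s * f s + ∑ s, (χ ^ 2) s * f s +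
        ∑ s, (χ ^ 3) s * f s := by
  rw [Finset.sum_filter, Finset.mul_sum, ← Finset.sum_add_distrib, ← Finset.sum_add_distrib,
    ← Finset.sum_add_distrib]
  refine Finset.sum_congr rfl fun s _ ↦ ?_
  rw [← add_mul, ← add_mul, ← add_mul, ← MulChar.four_mul_indicator hχ s]
  split_ifs <;> simp

open Classical in
-- The condition χ(-1) = 1 makes the Gauss sum of χ³ = χ⁻¹ the conjugate of that of χ.
theorem four_mul_sum_addChar_nonzeroPowers {F : Type*} [Field F] [Fintype F]
    {χ : MulChar F ℂ} (hχ : orderOf χ = 4) (h1 : χ (-1) = 1) {ψ : AddChar F ℂ}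
    (hψ : ψ.IsPrimitive) {a : F} (ha : a ≠ 0) :
    4 * ∑ s with s ∈ nonzeroPowers 4 F, ψ (a * s) =
      -1 + χ a ^ 3 * gaussSum χ ψ + χ a ^ 2 * gaussSum (χ ^ 2) ψ +
        χ a * star (gaussSum χ ψ) := by
  have hχ4 : χ ^ 4 = 1 := hχ ▸ pow_orderOf_eq_one χ
  have hshift (φ : MulChar F ℂ) :
      ∑ s, φ s * ψ (a * s) = φ⁻¹ a * gaussSum φ ψ := by
    simpa [gaussSum] using gaussSum_mulShift_eq φ ψ (Units.mk0 a ha)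
  have hinv : χ ^ 3 = χ⁻¹ := eq_inv_of_mul_eq_one_left (by rw [← pow_succ, hχ4])
  have hinv2 : (χ ^ 2)⁻¹ = χ ^ 2 := inv_eq_of_mul_eq_one_left (by rw [← pow_add, hχ4])
  have hstar : gaussSum χ⁻¹ ψ = star (gaussSum χ ψ) := by
    rw [star_gaussSum_eq, ← mul_gaussSum_inv_eq_gaussSum χ⁻¹ ψ, ← hinv,
      MulChar.pow_apply' _ three_ne_zero, h1]
    simp
  rw [four_mul_sum_nonzeroPowers hχ, hshift, hshift, hshift, hshift, hinv2, hinv, inv_inv, inv_one,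
    hstar, ← hinv, MulChar.pow_apply' _ two_ne_zero, MulChar.pow_apply' _ three_ne_zero,
    gaussSum_one_left (by simpa [AddChar.mulShift_one] using hψ one_ne_zero),
    MulChar.one_apply (isUnit_iff_ne_zero.mpr ha)]
  ring

open Classical in
-- For fourth roots of unity ζ and z, the right side of `h` is the character expansion of the
-- function equal to 1 at z = ζ and -1 elsewhere. Summed over a ≠ 0, only its constant term
-- survives, giving -(q-1)/2; this cancels the difference (q-1)/2 of the two degrees at a = 0.
theorem graphEnergy_eq_graphEnergy_compl {F : Type*} [Field F] [Fintype F] {G : SimpleGraph F}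
    (hG : ∀ v w, G.Adj v w ↔ w - v ∈ nonzeroPowers 4 F)
    {χ : MulChar F ℂ} (hχ : orderOf χ = 4) (h1 : χ (-1) = 1) {ψ : AddChar F ℂ}
    (hψ : ψ.IsPrimitive) (ζ : ℂ)
    (h : ∀ z l : ℂ, z ^ 4 = 1 → 4 * l = -1 + z ^ 3 * gaussSum χ ψ + z ^ 2 * gaussSum (χ ^ 2) ψ +
        z * star (gaussSum χ ψ) →
      ((‖1 + l‖ - ‖l‖ : ℝ) : ℂ) = (-1 + ζ ^ 3 * z + ζ ^ 2 * z ^ 2 + ζ * z ^ 3) / 2) :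
    graphEnergy G = graphEnergy Gᶜ := by
  set S : Finset F := Finset.univ.filter (· ∈ nonzeroPowers 4 F) with hS
  have hGS (v w : F) : G.Adj v w ↔ w - v ∈ S := by rw [hG, hS]; simp
  have h0 : 0 ∉ S := by
    rw [hS, Finset.mem_filter]
    rintro ⟨-, x, hx, h⟩
    exact pow_ne_zero _ hx h
  have hne {n : ℕ} (h0 : n ≠ 0) (h4 : n < 4) : χ ^ n ≠ 1 :=
    pow_ne_one_of_lt_orderOf h0 (hχ ▸ h4)
  have hχ1 : ∑ s, χ s = 0 := MulChar.sum_eq_zero_of_ne_one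
    (by simpa using hne (n := 1) (by norm_num) (by norm_num))
  have hχ2 : ∑ s, (χ ^ 2) s = 0 :=
    MulChar.sum_eq_zero_of_ne_one (hne (by norm_num) (by norm_num))
  have hχ3 : ∑ s, (χ ^ 3) s = 0 :=
    MulChar.sum_eq_zero_of_ne_one (hne (by norm_num) (by norm_num))
  have hone : ∑ s, (1 : MulChar F ℂ) s = (Fintype.card F : ℂ) - 1 := by
    rw [MulChar.sum_one_eq_card_units, Fintype.card_units, Nat.cast_pred Fintype.card_pos]
  have hcard : 4 * (S.card : ℂ) = Fintype.card F - 1 := by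
    have := four_mul_sum_nonzeroPowers hχ (fun _ ↦ 1)
    simp only [mul_one, hone, hχ1, hχ2, hχ3, add_zero] at this
    rw [← this, ← hS]
    simp
  have hcardR : 4 * (S.card : ℝ) = Fintype.card F - 1 := by exact_mod_cast hcard
  rw [graphEnergy_eq_sum_norm_charSum hψ G S hGS, graphEnergy_compl_eq_sum_norm hψ G S h0 hGS,
    eq_comm, ← sub_eq_zero, ← Finset.sum_sub_distrib, ← Complex.ofReal_inj, Complex.ofReal_sum]
  have key (a : F) : ((‖(if a = 0 then (Fintype.card F : ℂ) else 0) - 1 - ∑ s ∈ S, ψ (a * s)‖ -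
      ‖∑ s ∈ S, ψ (a * s)‖ : ℝ) : ℂ) = (if a = 0 then ((Fintype.card F : ℂ) - 1) / 2 else 0) +
        (-(1 : MulChar F ℂ) a + ζ ^ 3 * χ a + ζ ^ 2 * (χ ^ 2) a + ζ * (χ ^ 3) a) / 2 := by
    rcases eq_or_ne a 0 with rfl | ha
    · simp only [if_true, zero_mul, AddChar.map_zero_eq_one, Finset.sum_const, nsmul_eq_mul,
        mul_one, MulChar.map_zero, mul_zero, neg_zero, add_zero, zero_div]
      have e : (Fintype.card F : ℂ) - 1 - S.card = ((3 * S.card : ℕ) : ℂ) := by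
        push_cast
        linear_combination -hcard
      rw [e, Complex.norm_natCast, Complex.norm_natCast, ← hcard]
      push_cast
      ring
    · have hua := isUnit_iff_ne_zero.mpr ha
      have hz : χ a ^ 4 = 1 := by
        rw [← MulChar.pow_apply' χ four_ne_zero, ← hχ, pow_orderOf_eq_one, MulChar.one_apply hua]
      have := h (χ a) _ hz (four_mul_sum_addChar_nonzeroPowers hχ h1 hψ ha)
      rw [if_neg ha, if_neg ha, MulChar.one_apply hua, MulChar.pow_apply' _ two_ne_zero,
        MulChar.pow_apply' _ three_ne_zero, zero_add, ← this, zero_sub, ← neg_add', norm_neg]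
  rw [Finset.sum_congr rfl fun a _ ↦ key a, Finset.sum_add_distrib, ← Finset.sum_div,
    Finset.sum_add_distrib, Finset.sum_add_distrib, Finset.sum_add_distrib, ← Finset.mul_sum,
    ← Finset.mul_sum, ← Finset.mul_sum, hχ1, hχ2, hχ3, Finset.sum_neg_distrib, hone,
    Finset.sum_ite_eq']
  simp
  ring

/-! ### The map x ↦ x²-2 -/

/-- If |x| ≥ 1 from N on, then x²-2 ≥ -1, so later terms, not being -1, are ≥ 1. Then 2-x is
multiplied by 2+x ≥ 3 at each step, yet stays ≤ 1. -/
theorem exists_abs_lt_one_of_sq_sub_two {x : ℕ → ℝ} (hx : ∀ k, x (k + 1) = x k ^ 2 - 2)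
    (h2 : ∀ k, x k < 2) (h1 : ∀ k, x k ≠ -1) (N : ℕ) : ∃ k, N ≤ k ∧ |x k| < 1 := by
  by_contra! H
  have hge (j : ℕ) : 1 ≤ x (N + 1 + j) := by
    rcases le_abs.mp (H (N + 1 + j) (by omega)) with h | h
    · exact h
    · have hj := hx (N + j)
      have hN := one_le_sq_iff_one_le_abs _ |>.mpr (H (N + j) (by omega))
      rw [show N + j + 1 = N + 1 + j by ring] at hj
      exact absurd (by linarith) (h1 (N + 1 + j))
  have hgrow (j : ℕ) : 3 ^ j * (2 - x (N + 1)) ≤ 2 - x (N + 1 + j) := by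
    induction j with
    | zero => simp
    | succ j ih =>
      have h3 := hge j
      have h4 := h2 (N + 1 + j)
      have h5 := hx (N + 1 + j)
      have h6 := hge (j + 1)
      rw [← add_assoc] at h6
      rw [← add_assoc, pow_succ]
      nlinarith
  have hpos : 0 < 2 - x (N + 1) := sub_pos.mpr (h2 _)
  obtain ⟨j, hj⟩ := pow_unbounded_of_one_lt (1 / (2 - x (N + 1))) (by norm_num : (1 : ℝ) < 3)
  rw [div_lt_iff₀ hpos] at hj
  linarith [hgrow j, hge j]

/-! ### Signs of the four periods -/

theorem norm_one_add_sub_norm_of_nonneg {r : ℝ} (hr : 0 ≤ r) {l : ℂ} (hl : 4 * l = r) :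
    ‖1 + l‖ - ‖l‖ = 1 := by
  obtain rfl : l = ((r / 4 : ℝ) : ℂ) := by push_cast; linear_combination hl / 4
  rw [← Complex.ofReal_one, ← Complex.ofReal_add, Complex.norm_real, Complex.norm_real,
    Real.norm_eq_abs, Real.norm_eq_abs, abs_of_nonneg (by linarith), abs_of_nonneg (by linarith)]
  ring

theorem norm_one_add_sub_norm_of_le {r : ℝ} (hr : r ≤ -4) {l : ℂ} (hl : 4 * l = r) :
    ‖1 + l‖ - ‖l‖ = -1 := by
  obtain rfl : l = ((r / 4 : ℝ) : ℂ) := by push_cast; linear_combination hl / 4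
  rw [← Complex.ofReal_one, ← Complex.ofReal_add, Complex.norm_real, Complex.norm_real,
    Real.norm_eq_abs, Real.norm_eq_abs, abs_of_nonpos (by linarith), abs_of_nonpos (by linarith)]
  ring

theorem Complex.pow_four_eq_one_iff {z : ℂ} : z ^ 4 = 1 ↔ z = 1 ∨ z = -1 ∨ z = I ∨ z = -I := by
  constructor
  · intro h
    have h0 : (z - 1) * ((z + 1) * ((z - I) * (z + I))) = 0 := by
      linear_combination h - (z ^ 2 - 1) * I_sq
    rcases mul_eq_zero.mp h0 with h | h
    · exact Or.inl (sub_eq_zero.mp h)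
    rcases mul_eq_zero.mp h with h | h
    · exact Or.inr (Or.inl (eq_neg_of_add_eq_zero_left h))
    rcases mul_eq_zero.mp h with h | h
    · exact Or.inr (Or.inr (Or.inl (sub_eq_zero.mp h)))
    · exact Or.inr (Or.inr (Or.inr (eq_neg_of_add_eq_zero_left h)))
  · rintro (rfl | rfl | rfl | rfl)
    · exact one_pow 4
    · norm_num
    · exact I_pow_four
    · rw [Even.neg_pow (by decide), I_pow_four]

/-- At z = ±1 the margin 3 in `hc` is exactly what 4l ≤ -4 needs. At z = ±i the values are
-1+Q(1∓2s) with |2s| > √3, so they have opposite signs; ζ marks the nonnegative one. -/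
theorem exists_quartic_period_sign {Q c s : ℝ} (hQ : 25 ≤ Q) (hcs : c ^ 2 + s ^ 2 = 1)
    (hc : Q * |2 * c| ≤ Q - 3) :
    ∃ ζ : ℂ, ∀ z l : ℂ, z ^ 4 = 1 →
      4 * l = -1 + z ^ 3 * -(Q * (c + s * Complex.I)) + z ^ 2 * -Q +
        z * -(Q * (c - s * Complex.I)) →
      ((‖1 + l‖ - ‖l‖ : ℝ) : ℂ) = (-1 + ζ ^ 3 * z + ζ ^ 2 * z ^ 2 + ζ * z ^ 3) / 2 := by
  have hI3 : Complex.I ^ 3 = -Complex.I := Complex.I_pow_three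
  have hI2 := Complex.I_sq
  have hc1 : |2 * c| < 1 := by nlinarith [abs_nonneg (2 * c)]
  have hcl := abs_le.mp (show |Q * (2 * c)| ≤ Q - 3 by
    rwa [abs_mul, abs_of_nonneg (by linarith : 0 ≤ Q)])
  have hc2 := abs_lt.mp hc1
  have hs2 : 3 / 4 < s ^ 2 := by nlinarith
  have hone (l : ℂ) (hl : 4 * l = -1 + 1 ^ 3 * -(Q * (c + s * Complex.I)) + 1 ^ 2 * -Q +
        1 * -(Q * (c - s * Complex.I))) : ‖1 + l‖ - ‖l‖ = -1 := by
    refine norm_one_add_sub_norm_of_le (r := -1 - Q - Q * (2 * c)) (by linarith) ?_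
    rw [hl]
    push_cast
    ring
  have hneg (l : ℂ) (hl : 4 * l = -1 + (-1) ^ 3 * -(Q * (c + s * Complex.I)) + (-1) ^ 2 * -Q +
        -1 * -(Q * (c - s * Complex.I))) : ‖1 + l‖ - ‖l‖ = -1 := by
    refine norm_one_add_sub_norm_of_le (r := -1 - Q + Q * (2 * c)) (by linarith) ?_
    rw [hl]
    push_cast
    ring
  have hI (l : ℂ) (hl : 4 * l = -1 + Complex.I ^ 3 * -(Q * (c + s * Complex.I)) +
        Complex.I ^ 2 * -Q + Complex.I * -(Q * (c - s * Complex.I))) :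
      4 * l = ((-1 + Q * (1 - 2 * s) : ℝ) : ℂ) := by
    rw [hl, hI3]
    push_cast
    linear_combination (2 * Q * s - Q : ℂ) * hI2
  have hnI (l : ℂ) (hl : 4 * l = -1 + (-Complex.I) ^ 3 * -(Q * (c + s * Complex.I)) +
        (-Complex.I) ^ 2 * -Q + -Complex.I * -(Q * (c - s * Complex.I))) :
      4 * l = ((-1 + Q * (1 + 2 * s) : ℝ) : ℂ) := by
    rw [hl, neg_pow, hI3]
    push_cast
    linear_combination (-2 * Q * s - Q : ℂ) * hI2
  have hval {ζ z : ℂ} {r : ℝ} (hζ : ζ ^ 3 = -ζ) (hζ2 : ζ ^ 2 = -1)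
      (hr : (r : ℂ) = (-1 - ζ * z - z ^ 2 + ζ * z ^ 3) / 2) :
      (r : ℂ) = (-1 + ζ ^ 3 * z + ζ ^ 2 * z ^ 2 + ζ * z ^ 3) / 2 := by
    rw [hr, hζ, hζ2]
    ring
  rcases le_total 0 s with h0 | h0
  -- 17/10 is a rational lower bound for √3.
  · have hs : 17 / 10 < 2 * s := by nlinarith
    have hζ3 : (-Complex.I) ^ 3 = -(-Complex.I) := by rw [neg_pow, hI3]; ring
    have hζ2 : (-Complex.I) ^ 2 = -1 := by rw [neg_sq, hI2]
    refine ⟨-Complex.I, fun z l hz hl ↦ hval hζ3 hζ2 ?_⟩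
    rcases Complex.pow_four_eq_one_iff.mp hz with rfl | rfl | rfl | rfl
    · rw [hone l hl]; push_cast; ring
    · rw [hneg l hl]; push_cast; ring
    · rw [norm_one_add_sub_norm_of_le (by nlinarith) (hI l hl), hI3]
      push_cast; linear_combination -(1 / 2 : ℂ) * hI2
    · rw [norm_one_add_sub_norm_of_nonneg (by nlinarith) (hnI l hl), hζ3, hζ2]
      push_cast; linear_combination hI2
  · have hs : 2 * s < -(17 / 10) := by nlinarith
    refine ⟨Complex.I, fun z l hz hl ↦ hval hI3 hI2 ?_⟩
    rcases Complex.pow_four_eq_one_iff.mp hz with rfl | rfl | rfl | rfl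
    · rw [hone l hl]; push_cast; ring
    · rw [hneg l hl]; push_cast; ring
    · rw [norm_one_add_sub_norm_of_nonneg (by nlinarith) (hI l hl), hI3, hI2]
      push_cast; linear_combination hI2
    · rw [norm_one_add_sub_norm_of_le (by nlinarith) (hnI l hl), neg_pow _ 3, hI3]
      push_cast; linear_combination -(1 / 2 : ℂ) * hI2

/-! ### Traces of powers of a Gaussian integer -/

/-- For `a ^ 2 + b ^ 2 = p`, twice the real part of `(a + b i) ^ (2 ^ (k + 1))`. -/
def gaussianPowTrace (p : ℕ) (a : ℤ) : ℕ → ℤ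
  | 0 => 4 * a ^ 2 - 2 * p
  | k + 1 => gaussianPowTrace p a k ^ 2 - 2 * p ^ 2 ^ (k + 1)

/-- Modulo p the recursion is plain squaring, started at 4a². -/
theorem not_dvd_gaussianPowTrace {p : ℕ} (hp : p.Prime) (hp2 : p ≠ 2) {a : ℤ}
    (ha : ¬(p : ℤ) ∣ a) (k : ℕ) : ¬(p : ℤ) ∣ gaussianPowTrace p a k := by
  have hpZ : Prime (p : ℤ) := Nat.prime_iff_prime_int.mp hp
  induction k with
  | zero =>
    intro h
    rw [gaussianPowTrace, dvd_sub_left (Dvd.intro_left _ rfl)] at h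
    rcases hpZ.dvd_or_dvd h with h | h
    · have h4 : p ∣ 2 ^ 2 := by exact_mod_cast h
      exact hp2 ((Nat.prime_dvd_prime_iff_eq hp Nat.prime_two).mp (hp.dvd_of_dvd_pow h4))
    · exact ha (hpZ.dvd_of_dvd_pow h)
  | succ k ih =>
    intro h
    rw [gaussianPowTrace, dvd_sub_left (Dvd.dvd.mul_left (dvd_pow_self _ (by positivity)) _)] at h
    exact ih (hpZ.dvd_of_dvd_pow h)

theorem gaussianPowTrace_eq {p : ℕ} {a b : ℤ} (hab : a ^ 2 + b ^ 2 = p) (k : ℕ) :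
    (gaussianPowTrace p a k : ℂ) = ((a + b * Complex.I) ^ 2) ^ 2 ^ k +
      ((a - b * Complex.I) ^ 2) ^ 2 ^ k := by
  have habC : (a ^ 2 + b ^ 2 : ℂ) = p := by exact_mod_cast hab
  induction k with
  | zero =>
    rw [gaussianPowTrace]
    push_cast
    linear_combination -2 * b ^ 2 * Complex.I_sq + 2 * habC
  | succ k ih =>
    have hp : ((a + b * Complex.I) ^ 2) ^ 2 ^ k * ((a - b * Complex.I) ^ 2) ^ 2 ^ k =
        (p : ℂ) ^ 2 ^ (k + 1) := by
      rw [← mul_pow, ← mul_pow, ← habC, ← pow_mul, ← pow_succ']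
      congr 1
      linear_combination -b ^ 2 * Complex.I_sq
    rw [gaussianPowTrace]
    push_cast
    rw [ih, ← hp, pow_succ 2 k, pow_mul _ (2 ^ k) 2, pow_mul _ (2 ^ k) 2]
    ring

theorem exists_abs_gaussianPowTrace_lt {p : ℕ} (hp : p.Prime) (hp2 : p ≠ 2) {a b : ℤ}
    (hab : a ^ 2 + b ^ 2 = p) (N : ℕ) :
    ∃ k, N ≤ k ∧ |gaussianPowTrace p a k| < p ^ 2 ^ k := by
  have hp0 : (p : ℝ) ≠ 0 := by exact_mod_cast hp.ne_zero
  have hsq (n : ℤ) : n ^ 2 ≠ p := by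
    intro h
    have h' : n.natAbs ^ 2 = p := by
      zify
      simpa using h
    exact hp.prime.irreducible.not_isSquare ⟨n.natAbs, by rw [← h', sq]⟩
  -- A nonzero multiple of p has square at least p² > p, and a = 0 would make p a square.
  have ha : ¬(p : ℤ) ∣ a := by
    rintro ⟨c, rfl⟩
    have hb0 : b ≠ 0 := fun h ↦ hsq (p * c) (by simpa [h] using hab)
    have hc0 : c ≠ 0 := fun h ↦ hsq b (by simpa [h] using hab)
    have hp2' : (2 : ℤ) ≤ p := by exact_mod_cast hp.two_le
    have h1 : 0 < c ^ 2 := by positivity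
    replace h1 : 1 ≤ c ^ 2 := h1
    have h2 : (p : ℤ) ^ 2 * 1 ≤ (p : ℤ) ^ 2 * c ^ 2 := by gcongr
    nlinarith [sq_nonneg b]
  have hdvd := not_dvd_gaussianPowTrace hp hp2 ha
  set x : ℕ → ℝ := fun k ↦ gaussianPowTrace p a k / (p : ℝ) ^ 2 ^ k with hx
  have hne (k : ℕ) (n : ℤ) : x k ≠ n := by
    intro h
    rw [hx] at h
    simp only at h
    rw [div_eq_iff (pow_ne_zero _ hp0)] at h
    have h' : gaussianPowTrace p a k = n * p ^ 2 ^ k := by exact_mod_cast h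
    exact hdvd k (h' ▸ Dvd.dvd.mul_left (dvd_pow_self _ (by positivity)) _)
  have hrec (k : ℕ) : x (k + 1) = x k ^ 2 - 2 := by
    simp only [hx, gaussianPowTrace]
    push_cast
    rw [pow_succ 2 k, pow_mul]
    field_simp
  have hle (k : ℕ) : -2 ≤ x k ∧ x k ≤ 2 := by
    induction k with
    | zero =>
      have habR : (a ^ 2 + b ^ 2 : ℝ) = p := by exact_mod_cast hab
      have hp1 : (0 : ℝ) < p := by exact_mod_cast hp.pos
      simp only [hx, gaussianPowTrace, pow_zero, pow_one]
      push_cast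
      rw [le_div_iff₀ hp1, div_le_iff₀ hp1]
      constructor <;> nlinarith [sq_nonneg (a : ℝ), sq_nonneg (b : ℝ)]
    | succ k ih =>
      rw [hrec]
      constructor <;> nlinarith [sq_nonneg (x k)]
  obtain ⟨k, hk, hk1⟩ := exists_abs_lt_one_of_sq_sub_two hrec
    (fun k ↦ lt_of_le_of_ne (hle k).2 (by exact_mod_cast hne k 2))
    (fun k ↦ by exact_mod_cast hne k (-1)) N
  refine ⟨k, hk, ?_⟩
  have hpos : (0 : ℝ) < (p : ℝ) ^ 2 ^ k := by positivity
  simp only [hx] at hk1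
  rw [abs_div, abs_of_pos hpos, div_lt_one hpos] at hk1
  exact_mod_cast hk1

/-! ### Assembling the theorem -/

theorem equienergetic_gpGraph_four_compl {p : ℕ} [Fact p.Prime] (hp : p % 4 = 1) {a b : ℤ}
    (hab : a ^ 2 + b ^ 2 = p) {k : ℕ} (hk : |gaussianPowTrace p a k| < p ^ 2 ^ k)
    [Fintype (GaloisField p (4 * 2 ^ k))] {ψ : AddChar (GaloisField p (4 * 2 ^ k)) ℂ}
    {χ : MulChar (GaloisField p (4 * 2 ^ k)) ℂ} (hψ : ψ.IsPrimitive) (hχ : orderOf χ = 4)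
    (hg : gaussSum χ ψ = -((p : ℂ) * (a + b * Complex.I) ^ 2) ^ 2 ^ k)
    (hg2 : gaussSum (χ ^ 2) ψ = -((p : ℂ) ^ 2) ^ 2 ^ k) :
    Equienergetic (gpGraph 4 p (4 * 2 ^ k)) (gpGraph 4 p (4 * 2 ^ k))ᶜ := by
  refine ⟨rfl, ?_⟩
  have hadj := gpGraph_four_adj hp (ℓ := 2 ^ k) (by positivity)
  have hneg : χ (-1) = 1 := by
    have hne : (gpGraph 4 p (4 * 2 ^ k)).Adj 0 1 :=
      (hadj 0 1).mpr ⟨1, one_ne_zero, by simp⟩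
    have := (hadj 1 0).mp hne.symm
    have hiff := χ.apply_eq_one_iff_mem_nonzeroPowers
      (neg_ne_zero.mpr (one_ne_zero (α := GaloisField p (4 * 2 ^ k))))
    rw [hχ] at hiff
    exact hiff.mpr (by rwa [zero_sub] at this)
  have hp5 : 5 ≤ p := by
    have := (Fact.out : p.Prime).two_le
    omega
  have hp5' : (5 : ℝ) ≤ p := by exact_mod_cast hp5
  set P : ℝ := (p : ℝ) ^ 2 ^ k with hP
  have hP5 : 5 ≤ P := hp5'.trans (le_self_pow₀ (by linarith) (by positivity))
  have hP0 : (P : ℂ) ≠ 0 := by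
    rw [Ne, Complex.ofReal_eq_zero]
    linarith
  set z : ℂ := ((a + b * Complex.I) ^ 2) ^ 2 ^ k with hz
  have hzstar : star z = ((a - b * Complex.I) ^ 2) ^ 2 ^ k := by
    rw [hz]
    simp [sub_eq_add_neg]
  have hzz : z * star z = (P : ℂ) ^ 2 := by
    rw [hzstar, hz, ← mul_pow, ← mul_pow, hP]
    push_cast
    rw [← pow_mul _ (2 ^ k) 2, mul_comm (2 ^ k) 2, pow_mul]
    congr 2
    have habC : (a ^ 2 + b ^ 2 : ℂ) = p := by exact_mod_cast hab
    linear_combination -b ^ 2 * Complex.I_sq + habC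
  have htr : (gaussianPowTrace p a k : ℂ) = z + star z := by
    rw [gaussianPowTrace_eq hab, hzstar]
  have hre : (gaussianPowTrace p a k : ℝ) = 2 * z.re := by
    have := congrArg Complex.re htr
    simp only [Complex.intCast_re, Complex.add_re, Complex.star_def, Complex.conj_re] at this
    linarith
  have hnorm : z.re ^ 2 + z.im ^ 2 = P ^ 2 := by
    have := congrArg Complex.re hzz
    rw [Complex.star_def, Complex.mul_conj, Complex.ofReal_re, Complex.normSq_apply,
      ← Complex.ofReal_pow, Complex.ofReal_re] at this
    linarith
  -- Integrality sharpens the strict bound; multiplied by P it gives P²-P ≤ P²-3, the margin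
  -- required with Q = P².
  have hkR : |(gaussianPowTrace p a k : ℝ)| ≤ P - 1 := by
    have : |gaussianPowTrace p a k| ≤ p ^ 2 ^ k - 1 := by omega
    rw [hP]
    exact_mod_cast this
  have hPpos : 0 < P := by linarith
  obtain ⟨ζ, hζ⟩ := exists_quartic_period_sign (Q := P ^ 2) (c := z.re / P) (s := z.im / P)
    (by nlinarith) (by rw [div_pow, div_pow, ← add_div, hnorm, div_self (by positivity)])
    (by
      rw [← mul_div_assoc, ← hre, abs_div, abs_of_pos hPpos, sq, mul_assoc,
        mul_div_cancel₀ _ hPpos.ne']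
      nlinarith)
  have hzP : (P : ℂ) * z = ((P ^ 2 : ℝ) : ℂ) *
      (((z.re / P : ℝ) : ℂ) + ((z.im / P : ℝ) : ℂ) * Complex.I) := by
    conv_lhs => rw [← Complex.re_add_im z]
    push_cast
    field_simp
  have hg' : gaussSum χ ψ = -((P : ℂ) * z) := by
    rw [hg, mul_pow, hP]
    push_cast
    rfl
  have hg2' : gaussSum (χ ^ 2) ψ = -((P ^ 2 : ℝ) : ℂ) := by
    rw [hg2, hP, ← pow_mul, mul_comm, pow_mul]
    push_cast
    rfl
  refine graphEnergy_eq_graphEnergy_compl hadj hχ hneg hψ ζ fun w l hw hl ↦ hζ w l hw ?_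
  rw [hl, hg', hg2', hzP]
  simp [sub_eq_add_neg]

theorem theorem5p3 (p : ℕ) [Fact p.Prime] (hp : p ≡ 1 [MOD 4]) :
    {ℓ : ℕ | 0 < ℓ ∧ Equienergetic (gpGraph 4 p (4 * ℓ)) (gpGraph 4 p (4 * ℓ))ᶜ}.Infinite := by
  have hp1 : p % 4 = 1 := hp
  have hprime : p.Prime := Fact.out
  let _ (n : ℕ) : Fintype (GaloisField p n) := Fintype.ofFinite _
  obtain ⟨a, b, hab, h⟩ := GaloisField.exists_quartic_gaussSum p hp1
  refine Set.infinite_of_not_bddAbove fun ⟨N, hN⟩ ↦ ?_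
  obtain ⟨k, hk, hlt⟩ := exists_abs_gaussianPowTrace_lt hprime (by omega) hab N
  obtain ⟨ψ, χ, hψ, hχ, hg, hg2⟩ := h k
  have := hN ⟨by positivity, equienergetic_gpGraph_four_compl hp1 hab hlt hψ hχ hg hg2⟩
  exact absurd (Nat.lt_two_pow_self (n := k)) (by omega)
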